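/- Let $A$ be the discrete Laplacian on $\ell^2(\mathbb Z)$, i.e. $(Au)(k)=u(k-1)+u(k+1)$. For a bounded operator $B$ on a complex Hilbert space let $\sigma_{disc}(B)$ be the set of eigenvalues of $B$ that have finite algebraic multiplicity and are isolated from the rest of the spectrum; sums over $\sigma_{disc}(B)$ count every eigenvalue according to its algebraic multiplicity. Let $\gamma$ be a real number with $\gamma<1$. (1) There is a bounded rank-one operator $M$ on $\ell^2(\mathbb Z)$ such that, with $B=A+M$, $$\sum_{\lambda\in\sigma_{disc}(B)}\frac{\operatorname{dist}(\lambda,[-2,2])^{\gamma}}{|\lambda+2|^{\gamma/2}\,|\lambda-2|^{\gamma/2}}=+\infty .$$ (2) Consequently, for no $p>0$ is there a finite constant $K$ such that either one of the two bounds $$\sum_{\lambda\in\sigma_{disc}(B)}(1-|k(\lambda)|)^{\gamma}\le K\,\|B-A\|_{\mathbf S_p}^p,\qquad \sum_{\lambda\in\sigma_{disc}(B)}\frac{\operatorname{dist}(\lambda,[a,b])^{\gamma}}{|\lambda-a|^{\gamma/2}\,|\lambda-b|^{\gamma/2}}\le K\,\|B-A\|_{\mathbf S_p}^p$$ with $[a,b]=[-2,2]$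 holds for all bounded operators $A,B$ on separable complex Hilbert spaces such that $A$ is selfadjoint, $\sigma(A)=[a,b]$ and $B-A\in\mathbf S_p$. Here $\mathbf S_p$ is the Schatten class of compact operators with $\|C\|_{\mathbf S_p}^p=\sum_{n\ge0}\mu_n(C)^p<\infty$, $\mu_n(C)$ being the singular values, and $k$ is the conformal map of $(\mathbb C\cup\{\infty\})\setminus[a,b]$ onto the open unit disk given by $k(\lambda)=\zeta-\sqrt{\zeta^2-1}$ with $\zeta=\frac{2\lambda-(a+b)}{b-a}$, the square root being chosen such that $|k(\lambda)|<1$. -/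

import Mathlib

open scoped ENNReal NNReal

noncomputable section

/-! ### Discrete spectrum and algebraic multiplicity -/

section Operators

variable {H : Type*} [NormedAddCommGroup H] [InnerProductSpace ℂ H]

/-- The root subspace of `B` at `z`: the union over `n` of the kernels of `(B - z) ^ n`. -/
def rootSubspace (B : H →L[ℂ] H) (z : ℂ) : Submodule ℂ H :=
  Module.End.maxGenEigenspace (B : H →ₗ[ℂ] H) z

/-- The algebraic multiplicity of `z`: the dimension of the root subspace
(used only where this dimension is finite). -/
def algMult (B : H →L[ℂ] H) (z : ℂ) : ℕ :=
  Module.finrank ℂ (rootSubspace B z)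

/-- The discrete spectrum: the eigenvalues of `B` that have finite algebraic multiplicity and are
isolated from the rest of the spectrum. -/
def discreteSpectrum (B : H →L[ℂ] H) : Set ℂ :=
  {z | Module.End.HasEigenvalue (B : H →ₗ[ℂ] H) z ∧
    FiniteDimensional ℂ (rootSubspace B z) ∧
    ∃ ε : ℝ, 0 < ε ∧ ∀ w ∈ spectrum ℂ B, w ≠ z → ε ≤ dist w z}

/-! ### Schatten classes -/

/-- The `n`-th singular value of `C`, counted from `n = 0`: the distance from `C` to the operators
of rank at most `n`. For compact operators on a Hilbert space, this is the `n`-th eigenvalue of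
`|C|` in decreasing order. -/
def singularValue (C : H →L[ℂ] H) (n : ℕ) : ℝ≥0 :=
  ⨅ F : {F : H →L[ℂ] H // LinearMap.rank (F : H →ₗ[ℂ] H) ≤ n}, ‖C - F.1‖₊

/-- The `p`-th power of the Schatten norm: the sum of the `p`-th powers of the singular values. -/
def schattenPow (p : ℝ) (C : H →L[ℂ] H) : ℝ≥0∞ :=
  ∑' n : ℕ, ((singularValue C n ^ p : ℝ≥0) : ℝ≥0∞)

/-- Membership in the Schatten class `S_p`. -/
def InSchattenClass (p : ℝ) (C : H →L[ℂ] H) : Prop :=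
  IsCompactOperator C ∧ schattenPow p C < ∞

/-! ### The two eigenvalue sums -/

/-- The real interval `[a, b]` as a subset of the complex plane. -/
def realSegment (a b : ℝ) : Set ℂ := (fun x : ℝ => (x : ℂ)) '' Set.Icc a b

/-- The sum over the discrete spectrum of `B` of
`dist(z, [a, b]) ^ γ / (|z - a| ^ (γ / 2) * |z - b| ^ (γ / 2))`, each eigenvalue being counted
according to its algebraic multiplicity. The value `∞` means that the series of nonnegative terms
diverges. -/
def distSum (a b γ : ℝ) (B : H →L[ℂ] H) : ℝ≥0∞ :=
  ∑' z : discreteSpectrum B, (algMult B (z : ℂ) : ℝ≥0∞) *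
    ENNReal.ofReal (Metric.infDist (z : ℂ) (realSegment a b) ^ γ /
      (‖(z : ℂ) - a‖ ^ (γ / 2) * ‖(z : ℂ) - b‖ ^ (γ / 2)))

/-- The inverse of `z ↦ (z + z⁻¹) / 2`, as a map from the complement of `[-1, 1]` onto the
punctured unit disk: it is `ζ - √(ζ ^ 2 - 1)`, with the square root for which the modulus is less
than one. -/
def joukowskiInv (ζ : ℂ) : ℂ :=
  let s : ℂ := (ζ ^ 2 - 1) ^ (1 / 2 : ℂ)
  if ‖ζ - s‖ < 1 then ζ - s else ζ + s

/-- The conformal map from the complement of `[a, b]` to the unit disk that sends `∞` to `0`. -/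
def conformalK (a b : ℝ) (z : ℂ) : ℂ :=
  joukowskiInv ((2 * z - (b + a)) / (b - a))

/-- The sum over the discrete spectrum of `B` of `(1 - |k(z)|) ^ γ`, where `k` is the conformal map
from the complement of `[a, b]` to the unit disk, each eigenvalue being counted according to its
algebraic multiplicity. -/
def conformalSum (a b γ : ℝ) (B : H →L[ℂ] H) : ℝ≥0∞ :=
  ∑' z : discreteSpectrum B, (algMult B (z : ℂ) : ℝ≥0∞) *
    ENNReal.ofReal ((1 - ‖conformalK a b (z : ℂ)‖) ^ γ)

end Operators

/-! ### The two eigenvalue bounds -/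

/-- The bound `∑ (1 - |k(z)|) ^ γ ≤ K * ‖B - A‖_{S_p} ^ p`, with a finite constant `K`, for all
bounded operators `A`, `B` on separable Hilbert spaces such that `A` is selfadjoint with spectrum
`[a, b]` and `B - A` belongs to `S_p`. -/
def ConformalBound (a b p γ : ℝ) : Prop :=
  ∃ K : ℝ≥0, ∀ (H : Type) [NormedAddCommGroup H] [InnerProductSpace ℂ H] [CompleteSpace H]
    [TopologicalSpace.SeparableSpace H] (A B : H →L[ℂ] H),
    IsSelfAdjoint A → spectrum ℂ A = realSegment a b → InSchattenClass p (B - A) →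
      conformalSum a b γ B ≤ K * schattenPow p (B - A)

/-- The bound `∑ dist(z, [a, b]) ^ γ / (|z - a| ^ (γ / 2) * |z - b| ^ (γ / 2)) ≤
K * ‖B - A‖_{S_p} ^ p`, with a finite constant `K`, for all bounded operators `A`, `B` on separable
Hilbert spaces such that `A` is selfadjoint with spectrum `[a, b]` and `B - A` belongs to `S_p`. -/
def DistBound (a b p γ : ℝ) : Prop :=
  ∃ K : ℝ≥0, ∀ (H : Type) [NormedAddCommGroup H] [InnerProductSpace ℂ H] [CompleteSpace H]
    [TopologicalSpace.SeparableSpace H] (A B : H →L[ℂ] H),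
    IsSelfAdjoint A → spectrum ℂ A = realSegment a b → InSchattenClass p (B - A) →
      distSum a b γ B ≤ K * schattenPow p (B - A)

/-! ### The discrete Laplacian -/

/-- The Hilbert space of square summable functions from `ℤ` to `ℂ`. -/
abbrev L2Z : Type := lp (fun _ : ℤ => ℂ) 2

theorem memlp_shift (u : L2Z) (n : ℤ) : Memℓp (fun k : ℤ => (u : ℤ → ℂ) (k + n)) 2 := by
  have h := (lp.memℓp u).summable (by norm_num)
  exact memℓp_gen ((Equiv.addRight n).summable_iff.mpr h)

/-- The shift `(S u)(k) = u(k + n)`. -/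
def shiftL2Z (n : ℤ) : L2Z →ₗᵢ[ℂ] L2Z where
  toFun u := ⟨fun k => (u : ℤ → ℂ) (k + n), memlp_shift u n⟩
  map_add' _ _ := rfl
  map_smul' _ _ := rfl
  norm_map' u := by
    have h2 : 0 < (2 : ℝ≥0∞).toReal := by norm_num
    rw [lp.norm_eq_tsum_rpow h2, lp.norm_eq_tsum_rpow h2]
    congr 1
    exact (Equiv.addRight n).tsum_eq (fun k => ‖(u : ℤ → ℂ) k‖ ^ (2 : ℝ≥0∞).toReal)

/-- The discrete Laplacian (free Schrödinger operator) `(A u)(k) = u(k - 1) + u(k + 1)`. -/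
def discreteLaplacian : L2Z →L[ℂ] L2Z :=
  (shiftL2Z (-1)).toContinuousLinearMap + (shiftL2Z 1).toContinuousLinearMap

theorem discreteLaplacian_apply (u : L2Z) (k : ℤ) :
    (discreteLaplacian u : ℤ → ℂ) k = (u : ℤ → ℂ) (k - 1) + (u : ℤ → ℂ) (k + 1) := rfl

end

/-! For a rank-one perturbation `A + φ.smulRight ψ`, a zero of F(w) = 1 - φ((w - A)⁻¹ψ) in the
resolvent set of `A` is an eigenvalue, and it is discrete unless F vanishes identically nearby. Put
w = z + z⁻¹ with 0 < |z| < 1, and let ψ be the difference of the unit vectors at 1 and -1. The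
resolvent of the Laplacian sends ψ to the odd sequence with entries z ^ k for k ≥ 1, so a suitable φ
turns F(z + z⁻¹) into any prescribed power series with square summable coefficients and constant
term 1 (`resolvent_dipole`, `exists_functional`).

The zeros may thus be those of any normalised H² function. A Blaschke product provides zeros i r_n
whenever ∑ (1 - r_n) converges (`exists_L2N_zeros`, then a rotation), and since γ < 1 the r_n can be
chosen with ∑ (1 - r_n)^γ divergent (`exists_radii`). The eigenvalues i (r_n - r_n⁻¹) tend to 0,
away from the endpoints ±2, so the summands of both series are comparable to (1 - r_n)^γ. The
perturbation has rank one, hence finite Schatten norms for all p > 0, and no finite `K` can exist.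
-/

noncomputable section

/-! ### Rank-one perturbations: zeros of the determinant are discrete eigenvalues -/

section RankOne

open Filter Topology Module

variable {H : Type*} [NormedAddCommGroup H] [InnerProductSpace ℂ H]

theorem sub_apply_resolvent {A : H →L[ℂ] H} {w : ℂ} (hw : w ∈ resolventSet ℂ A) (v : H) :
    w • resolvent A w v - A (resolvent A w v) = v := by
  have h : (algebraMap ℂ (H →L[ℂ] H) w - A) * resolvent A w = 1 := Ring.mul_inverse_cancel _ hw
  simpa [Algebra.algebraMap_eq_smul_one] using congrArg (fun T : H →L[ℂ] H => T v) h

theorem resolvent_sub_apply {A : H →L[ℂ] H} {w : ℂ} (hw : w ∈ resolventSet ℂ A) (v : H) :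
    resolvent A w (w • v - A v) = v := by
  have h : resolvent A w * (algebraMap ℂ (H →L[ℂ] H) w - A) = 1 := Ring.inverse_mul_cancel _ hw
  simpa [Algebra.algebraMap_eq_smul_one] using congrArg (fun T : H →L[ℂ] H => T v) h

/-- The perturbation determinant of the rank-one perturbation `A + φ.smulRight ψ` of `A`. -/
def pertDet (A : H →L[ℂ] H) (φ : H →L[ℂ] ℂ) (ψ : H) (w : ℂ) : ℂ :=
  1 - φ (resolvent A w ψ)

/-- The Sherman–Morrison formula gives the inverse `S` explicitly; the determinant is its only
denominator. -/
theorem mem_resolventSet_add_smulRight {A : H →L[ℂ] H} {φ : H →L[ℂ] ℂ} {ψ : H} {w : ℂ}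
    (hw : w ∈ resolventSet ℂ A) (hF : pertDet A φ ψ w ≠ 0) :
    w ∈ resolventSet ℂ (A + φ.smulRight ψ) := by
  set R := resolvent A w with hR
  have hF' : 1 - φ (R ψ) ≠ 0 := hF
  let S : H →L[ℂ] H := R + (1 - φ (R ψ))⁻¹ • (φ.comp R).smulRight (R ψ)
  have hR1 : ∀ v, A (R v) = w • R v - v := fun v => by
    rw [eq_sub_iff_add_eq, add_comm, ← eq_sub_iff_add_eq]; exact (sub_apply_resolvent hw v).symm
  have hR2 : ∀ v, R (A v) = w • R v - v := fun v => by
    have := resolvent_sub_apply hw v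
    rw [map_sub, map_smul] at this
    rw [eq_sub_iff_add_eq, add_comm, ← eq_sub_iff_add_eq]; exact this.symm
  have h1 : (algebraMap ℂ (H →L[ℂ] H) w - (A + φ.smulRight ψ)) * S = 1 := by
    ext v
    have key : w • S v - (A (S v) + φ (S v) • ψ) = v := by
      have hS : S v = R v + ((1 - φ (R ψ))⁻¹ * φ (R v)) • R ψ := by simp [S, smul_smul]
      rw [hS]
      simp only [map_add, map_smul, hR1, smul_eq_mul]
      have : φ (R v) + (1 - φ (R ψ))⁻¹ * φ (R v) * φ (R ψ) = (1 - φ (R ψ))⁻¹ * φ (R v) := by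
        field_simp; ring
      rw [this]
      module
    simpa [Algebra.algebraMap_eq_smul_one] using key
  have h2 : S * (algebraMap ℂ (H →L[ℂ] H) w - (A + φ.smulRight ψ)) = 1 := by
    ext v
    have key : S (w • v - (A v + φ v • ψ)) = v := by
      have hS : ∀ v, S v = R v + ((1 - φ (R ψ))⁻¹ * φ (R v)) • R ψ := by simp [S, smul_smul]
      have hRv : R (w • v - (A v + φ v • ψ)) = v - φ v • R ψ := by
        simp only [map_add, map_smul, map_sub, hR2]; module
      rw [hS, hRv]
      simp only [map_sub, map_smul, smul_eq_mul]
      have : (1 - φ (R ψ))⁻¹ * (φ v - φ v * φ (R ψ)) = φ v := by field_simp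
      rw [this]
      module
    simpa [Algebra.algebraMap_eq_smul_one] using key
  exact ⟨⟨_, S, h1, h2⟩, rfl⟩

theorem apply_resolvent_eq_smul {A : H →L[ℂ] H} {φ : H →L[ℂ] ℂ} {ψ : H} {z : ℂ}
    (hz : z ∈ resolventSet ℂ A) (hF : pertDet A φ ψ z = 0) :
    (A + φ.smulRight ψ) (resolvent A z ψ) = z • resolvent A z ψ := by
  have h1 : φ (resolvent A z ψ) = 1 := (sub_eq_zero.mp hF).symm
  have h2 := sub_apply_resolvent hz ψ
  simp only [_root_.add_apply, ContinuousLinearMap.smulRight_apply, h1, one_smul]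
  rw [sub_eq_iff_eq_add.mp h2, add_comm]

/-- An eigenvector satisfies (z - A) v = φ(v) ψ, hence v = φ(v) (z - A)⁻¹ψ. So the geometric
multiplicity is at most one. -/
theorem ker_sub_le_span {A : H →L[ℂ] H} {φ : H →L[ℂ] ℂ} {ψ : H} {z : ℂ}
    (hz : z ∈ resolventSet ℂ A) :
    LinearMap.ker ((A + φ.smulRight ψ : H →L[ℂ] H) - algebraMap ℂ (H →L[ℂ] H) z : H →ₗ[ℂ] H) ≤
      Submodule.span ℂ {resolvent A z ψ} := by
  intro v hv
  have hv' : A v + φ v • ψ - z • v = 0 := by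
    simpa [Algebra.algebraMap_eq_smul_one] using hv
  rw [Submodule.mem_span_singleton]
  refine ⟨φ v, ?_⟩
  rw [← map_smul]
  conv_rhs => rw [← resolvent_sub_apply hz v]
  congr 1
  rw [eq_sub_iff_add_eq, add_comm]
  exact sub_eq_zero.mp hv'

theorem finiteDimensional_ker_pow {K V : Type*} [Field K] [AddCommGroup V] [Module K V]
    (N : End K V) (h : FiniteDimensional K (LinearMap.ker N)) (n : ℕ) :
    FiniteDimensional K (LinearMap.ker (N ^ n)) := by
  induction n with
  | zero => rw [pow_zero, End.one_eq_id, LinearMap.ker_id]; infer_instance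
  | succ n ih =>
    rw [← Submodule.fg_iff_finiteDimensional]
    apply Submodule.fg_of_fg_map_of_fg_inf_ker N
    · rw [Submodule.fg_iff_finiteDimensional]
      refine Submodule.finiteDimensional_of_le (S₂ := LinearMap.ker (N ^ n)) ?_
      rw [Submodule.map_le_iff_le_comap]
      intro v hv
      simpa [pow_succ] using hv
    · rw [Submodule.fg_iff_finiteDimensional]
      exact Submodule.finiteDimensional_of_le inf_le_right

variable [CompleteSpace H]

theorem analyticAt_pertDet {A : H →L[ℂ] H} (φ : H →L[ℂ] ℂ) (ψ : H) {z : ℂ}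
    (hz : z ∈ resolventSet ℂ A) : AnalyticAt ℂ (pertDet A φ ψ) z := by
  have hd : DifferentiableOn ℂ (resolvent A) (resolventSet ℂ A) := fun w hw =>
    (spectrum.hasDerivAt_resolvent_const_left hw).differentiableAt.differentiableWithinAt
  have hd' : DifferentiableOn ℂ (pertDet A φ ψ) (resolventSet ℂ A) := by
    unfold pertDet
    fun_prop
  exact hd'.analyticAt ((spectrum.isOpen_resolventSet A).mem_nhds hz)

/-- The length of Jordan chains at a zero of the perturbation determinant is at most the order of
the zero. -/
theorem ker_pow_succ_le {A : H →L[ℂ] H} {φ : H →L[ℂ] ℂ} {ψ : H} {z : ℂ}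
    (hz : z ∈ resolventSet ℂ A) {m : ℕ} {g : ℂ → ℂ} (hg : ContinuousAt g z) (hg0 : g z ≠ 0)
    (hFg : ∀ᶠ w in 𝓝 z, pertDet A φ ψ w = (w - z) ^ m • g w) {v : H}
    (hv : (((A + φ.smulRight ψ) - algebraMap ℂ (H →L[ℂ] H) z) ^ (m + 1)) v = 0) :
    (((A + φ.smulRight ψ) - algebraMap ℂ (H →L[ℂ] H) z) ^ m) v = 0 := by
  set N := (A + φ.smulRight ψ) - algebraMap ℂ (H →L[ℂ] H) z with hN
  -- The geometric sum for N^(m+1) - (w - z)^(m+1). As N^(m+1) v = 0, it gives (w - B) Q(w) v = (w -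
  -- z)^(m+1) v for the perturbed operator B, while Q(z) = N^m.
  let Q : ℂ → (H →L[ℂ] H) := fun w =>
    ∑ i ∈ Finset.range (m + 1), N ^ i * (algebraMap ℂ (H →L[ℂ] H) (w - z)) ^ (m + 1 - 1 - i)
  have hQc : Continuous Q := by
    have : Continuous (algebraMap ℂ (H →L[ℂ] H)) := continuous_algebraMap _ _
    fun_prop
  have hQz : Q z = N ^ m := by
    simp only [Q, sub_self, map_zero]
    rw [Finset.sum_eq_single m]
    · simp
    · intro i hi hne
      rw [zero_pow, mul_zero]
      have := Finset.mem_range.mp hi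
      omega
    · simp
  have hQe : ∀ w, (N - algebraMap ℂ (H →L[ℂ] H) (w - z)) (Q w v) = -((w - z) ^ (m + 1) • v) := by
    intro w
    have h := (show Commute N (algebraMap ℂ (H →L[ℂ] H) (w - z)) from
      (Algebra.commutes (w - z) N).symm).mul_geom_sum₂ (m + 1)
    have h' := congrArg (fun T : H →L[ℂ] H => T v) h
    simp only [mul_apply_eq_comp, _root_.sub_apply] at h' ⊢
    rw [h', hv, ← map_pow]
    simp [Algebra.algebraMap_eq_smul_one]
  -- The rank-one resolvent formula applied to Q(w) v, multiplied by the determinant so that nothing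
  -- is divided by its zero at `z`.
  have hQs : ∀ w ∈ resolventSet ℂ A, pertDet A φ ψ w • Q w v =
      (w - z) ^ (m + 1) • (pertDet A φ ψ w • resolvent A w v +
        φ (resolvent A w v) • resolvent A w ψ) := by
    intro w hw
    have h1 : w • Q w v - A (Q w v) = (w - z) ^ (m + 1) • v + φ (Q w v) • ψ := by
      have := hQe w
      simp only [hN, _root_.sub_apply, _root_.add_apply,
        Algebra.algebraMap_eq_smul_one, _root_.smul_apply,
        one_apply_eq_self, ContinuousLinearMap.smulRight_apply] at this
      rw [eq_neg_iff_add_eq_zero] at this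
      rw [← sub_eq_zero, ← neg_eq_zero, ← this]
      module
    have h2 : Q w v = (w - z) ^ (m + 1) • resolvent A w v + φ (Q w v) • resolvent A w ψ := by
      conv_lhs => rw [← resolvent_sub_apply hw (Q w v), h1]
      simp
    have h3 : φ (Q w v) * pertDet A φ ψ w = (w - z) ^ (m + 1) * φ (resolvent A w v) := by
      have := congrArg φ h2
      simp only [map_add, map_smul, smul_eq_mul] at this
      unfold pertDet
      linear_combination this
    conv_lhs => rw [h2, smul_add, smul_smul, smul_smul, mul_comm _ (φ (Q w v)), h3]
    module
  have hRc : ContinuousAt (resolvent A) z :=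
    (spectrum.hasDerivAt_resolvent_const_left hz).continuousAt
  have hl : Tendsto (fun w => g w • Q w v) (𝓝[≠] z) (𝓝 (g z • (N ^ m) v)) := by
    rw [← hQz]
    have : ContinuousAt (fun w => g w • Q w v) z := by fun_prop
    exact this.tendsto.mono_left nhdsWithin_le_nhds
  have hr : Tendsto (fun w => (w - z) • (pertDet A φ ψ w • resolvent A w v +
        φ (resolvent A w v) • resolvent A w ψ)) (𝓝[≠] z) (𝓝 0) := by
    have hc := (analyticAt_pertDet φ ψ hz).continuousAt
    have : ContinuousAt (fun w => (w - z) • (pertDet A φ ψ w • resolvent A w v +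
        φ (resolvent A w v) • resolvent A w ψ)) z := by fun_prop
    have := this.tendsto.mono_left (nhdsWithin_le_nhds (s := {z}ᶜ))
    simpa using this
  -- Cancelling (w - z)^m leaves one factor w - z on the right, so the limit w → z gives g(z) N^m v
  -- = 0.
  have he : (fun w => g w • Q w v) =ᶠ[𝓝[≠] z] fun w => (w - z) • (pertDet A φ ψ w • resolvent A w v +
        φ (resolvent A w v) • resolvent A w ψ) := by
    filter_upwards [self_mem_nhdsWithin, hFg.filter_mono nhdsWithin_le_nhds,
      ((spectrum.isOpen_resolventSet A).eventually_mem hz).filter_mono nhdsWithin_le_nhds] with w h1 h2 h3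
    have hne : (w - z) ^ m ≠ 0 := pow_ne_zero _ (sub_ne_zero.mpr h1)
    have h4 := hQs w h3
    rw [← sub_eq_zero] at h4 ⊢
    rw [← smul_eq_zero_iff_right hne, ← h4]
    conv_rhs => enter [1]; rw [h2]
    rw [pow_succ]
    module
  have := tendsto_nhds_unique (hl.congr' he) hr
  exact (smul_eq_zero.mp this).resolve_left hg0

/-- A point of the resolvent set of `A` that is an isolated zero of the perturbation determinant
belongs to the discrete spectrum of the perturbed operator. -/
theorem mem_discreteSpectrum_add_smulRight {A : H →L[ℂ] H} {φ : H →L[ℂ] ℂ} {ψ : H} {z : ℂ}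
    (hz : z ∈ resolventSet ℂ A) (hF : pertDet A φ ψ z = 0)
    (hF' : ¬ ∀ᶠ w in 𝓝 z, pertDet A φ ψ w = 0) :
    z ∈ discreteSpectrum (A + φ.smulRight ψ) := by
  have han := analyticAt_pertDet φ ψ hz
  refine ⟨?_, ?_, ?_⟩
  · refine Module.End.hasEigenvalue_of_hasEigenvector (x := resolvent A z ψ)
      (Module.End.hasEigenvector_iff.mpr ⟨Module.End.mem_eigenspace_iff.mpr
        (apply_resolvent_eq_smul hz hF), ?_⟩)
    intro h0
    simp [pertDet, h0] at hF
  · obtain ⟨m, g, hg, hg0, hFg⟩ := han.exists_eventuallyEq_pow_smul_nonzero_iff.mpr hF'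
    set N := (A + φ.smulRight ψ) - algebraMap ℂ (H →L[ℂ] H) z with hN
    have hNe : ((A + φ.smulRight ψ : H →L[ℂ] H) : End ℂ H) - algebraMap ℂ (End ℂ H) z =
        (N : End ℂ H) := by
      ext v; simp [hN, Algebra.algebraMap_eq_smul_one]
    have hpow : ∀ k (v : H), ((N : End ℂ H) ^ k) v = (N ^ k) v := by
      intro k v
      induction k generalizing v with
      | zero => simp
      | succ k ih => simp [pow_succ, ih]
    -- The kernels of the powers of `N` stop growing at the order `m` of the zero, so the root
    -- subspace lies in the kernel of N^m.
    have hle : ∀ k (v : H), (N ^ k) v = 0 → (N ^ m) v = 0 := by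
      intro k
      induction k with
      | zero => intro v hv; simp at hv; simp [hv]
      | succ k ih =>
        intro v hv
        apply ker_pow_succ_le hz hg.continuousAt hg0 hFg
        rw [pow_succ]
        exact ih _ (by rwa [pow_succ] at hv)
    have hker : FiniteDimensional ℂ (LinearMap.ker (N : End ℂ H)) :=
      Submodule.finiteDimensional_of_le (ker_sub_le_span hz)
    have := finiteDimensional_ker_pow (N : End ℂ H) hker m
    refine Submodule.finiteDimensional_of_le (S₂ := LinearMap.ker ((N : End ℂ H) ^ m)) ?_
    intro v hv
    obtain ⟨k, hk⟩ := (Module.End.mem_maxGenEigenspace _ _ _).mp hv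
    rw [← Algebra.algebraMap_eq_smul_one, hNe, hpow] at hk
    rw [LinearMap.mem_ker, hpow]
    exact hle k v hk
  · have hev : ∀ᶠ w in 𝓝[≠] z, pertDet A φ ψ w ≠ 0 :=
      han.eventually_eq_zero_or_eventually_ne_zero.resolve_left hF'
    have hev2 := hev.and (((spectrum.isOpen_resolventSet A).eventually_mem hz).filter_mono
      nhdsWithin_le_nhds)
    rw [eventually_nhdsWithin_iff, Metric.eventually_nhds_iff] at hev2
    obtain ⟨ε, hε, h⟩ := hev2
    refine ⟨ε, hε, fun w hw hne => ?_⟩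
    by_contra! hlt
    obtain ⟨h1, h2⟩ := h hlt hne
    exact hw (mem_resolventSet_add_smulRight h2 h1)

theorem one_le_algMult {H : Type*} [NormedAddCommGroup H] [InnerProductSpace ℂ H]
    {B : H →L[ℂ] H} {z : ℂ} (hz : z ∈ discreteSpectrum B) : 1 ≤ algMult B z := by
  obtain ⟨h1, h2, -⟩ := hz
  obtain ⟨v, hv⟩ := h1.exists_hasEigenvector
  have hmem : v ∈ rootSubspace B z := by
    refine (Module.End.mem_maxGenEigenspace _ _ _).mpr ⟨1, ?_⟩
    rw [pow_one, LinearMap.sub_apply, hv.apply_eq_smul, LinearMap.smul_apply, Module.End.one_apply,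
      sub_self]
  have : Nontrivial (rootSubspace B z) :=
    ⟨⟨v, hmem⟩, 0, fun h => hv.2 (congrArg Subtype.val h)⟩
  exact Module.finrank_pos

end RankOne

/-! ### Blaschke products as functions of an isometry -/

section Blaschke

open Filter Topology

section Isometry

variable {H : Type*} [NormedAddCommGroup H] [InnerProductSpace ℂ H]

/-- Since `r` is real and `S` isometric, both squares expand to (1 + r²)‖u‖² - 2r Re⟨u, S u⟩. This
makes Blaschke factors isometric. -/
theorem norm_smul_sub_isometry (S : H →ₗᵢ[ℂ] H) (r : ℝ) (u : H) :
    ‖(r : ℂ) • u - S u‖ = ‖u - (r : ℂ) • S u‖ := by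
  rw [← sq_eq_sq₀ (norm_nonneg _) (norm_nonneg _), @norm_sub_sq ℂ, @norm_sub_sq ℂ]
  simp only [norm_smul, inner_smul_left, inner_smul_right, S.norm_map, Complex.conj_ofReal]
  ring

variable [CompleteSpace H]

theorem isUnit_one_sub_smul_isometry (S : H →ₗᵢ[ℂ] H) {r : ℝ} (hr : |r| < 1) :
    IsUnit (1 - (r : ℂ) • S.toContinuousLinearMap : H →L[ℂ] H) := by
  apply isUnit_one_sub_of_norm_lt_one
  rw [norm_smul]
  calc ‖(r : ℂ)‖ * ‖S.toContinuousLinearMap‖ ≤ ‖(r : ℂ)‖ * 1 := by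
        gcongr; exact S.norm_toContinuousLinearMap_le
    _ < 1 := by simpa using hr

/-- The Blaschke factor `(r - S) (1 - r S)⁻¹` of an isometry `S`. -/
def blaschkeFactor (S : H →ₗᵢ[ℂ] H) (r : ℝ) : H →L[ℂ] H :=
  ((r : ℂ) • 1 - S.toContinuousLinearMap) * Ring.inverse (1 - (r : ℂ) • S.toContinuousLinearMap)

theorem exists_blaschkeFactor_apply (S : H →ₗᵢ[ℂ] H) {r : ℝ} (hr : |r| < 1) (u : H) :
    ∃ v, v - (r : ℂ) • S v = u ∧ blaschkeFactor S r u = (r : ℂ) • v - S v := by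
  refine ⟨Ring.inverse (1 - (r : ℂ) • S.toContinuousLinearMap) u, ?_, ?_⟩
  · have := congrArg (fun T : H →L[ℂ] H => T u)
      (Ring.mul_inverse_cancel _ (isUnit_one_sub_smul_isometry S hr))
    simpa using this
  · simp [blaschkeFactor]

theorem norm_blaschkeFactor_apply (S : H →ₗᵢ[ℂ] H) {r : ℝ} (hr : |r| < 1) (u : H) :
    ‖blaschkeFactor S r u‖ = ‖u‖ := by
  obtain ⟨v, h1, h2⟩ := exists_blaschkeFactor_apply S hr u
  rw [h2, norm_smul_sub_isometry, h1]

/-- In the Hardy space model `S` is multiplication by the variable and `e` is evaluation at `y`; no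
function theory beyond this intertwining relation is needed. -/
theorem eval_blaschkeFactor_apply (S : H →ₗᵢ[ℂ] H) {r : ℝ} (hr : |r| < 1) {e : H →L[ℂ] ℂ} {y : ℂ}
    (he : ∀ u, e (S u) = y * e u) (u : H) :
    (1 - r * y) * e (blaschkeFactor S r u) = (r - y) * e u := by
  obtain ⟨v, h1, h2⟩ := exists_blaschkeFactor_apply S hr u
  rw [h2, ← h1]
  simp only [map_sub, map_smul, he, smul_eq_mul]
  ring

/-- Finite Blaschke products of an isometry. -/
def blaschkeProd (S : H →ₗᵢ[ℂ] H) (r : ℕ → ℝ) : ℕ → H →L[ℂ] H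
  | 0 => 1
  | n + 1 => blaschkeProd S r n * blaschkeFactor S (r n)

theorem norm_blaschkeProd_apply (S : H →ₗᵢ[ℂ] H) {r : ℕ → ℝ} (hr : ∀ n, |r n| < 1) (n : ℕ) (u : H) :
    ‖blaschkeProd S r n u‖ = ‖u‖ := by
  induction n generalizing u with
  | zero => simp [blaschkeProd]
  | succ n ih => simp [blaschkeProd, ih, norm_blaschkeFactor_apply S (hr n)]

theorem eval_blaschkeProd_apply_eq_zero (S : H →ₗᵢ[ℂ] H) {r : ℕ → ℝ} (hr : ∀ n, |r n| < 1)
    {e : H →L[ℂ] ℂ} {j : ℕ} (he : ∀ u, e (S u) = r j * e u) {n : ℕ} (hn : j < n) (u : H) :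
    e (blaschkeProd S r n u) = 0 := by
  have hne : ∀ k, (1 - r k * r j : ℂ) ≠ 0 := by
    intro k h
    have h1 : r k * r j = 1 := by
      have := sub_eq_zero.mp h
      exact_mod_cast this.symm
    have h2 := mul_lt_mul'' (hr k) (hr j) (abs_nonneg _) (abs_nonneg _)
    rw [← abs_mul, h1] at h2
    simp at h2
  induction n generalizing u with
  | zero => omega
  | succ n ih =>
    rw [blaschkeProd, mul_apply_eq_comp]
    rcases Nat.lt_succ_iff_lt_or_eq.mp hn with h | rfl
    · exact ih h _
    -- The factor with index `j` acts first here and creates the zero; all other factors preserve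
    -- the kernel of `e`.
    · have hz : ∀ m v, e v = 0 → e (blaschkeProd S r m v) = 0 := by
        intro m
        induction m with
        | zero => intro v hv; simpa [blaschkeProd] using hv
        | succ m ihm =>
          intro v hv
          rw [blaschkeProd, mul_apply_eq_comp]
          apply ihm
          have := eval_blaschkeFactor_apply S (hr m) he v
          rw [hv, mul_zero] at this
          exact (mul_eq_zero.mp this).resolve_left (hne m)
      apply hz
      have := eval_blaschkeFactor_apply S (hr j) he u
      rw [sub_self, zero_mul] at this
      exact (mul_eq_zero.mp this).resolve_left (hne j)

theorem eval_zero_blaschkeProd_apply (S : H →ₗᵢ[ℂ] H) {r : ℕ → ℝ} (hr : ∀ n, |r n| < 1)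
    {e : H →L[ℂ] ℂ} (he : ∀ u, e (S u) = 0) (n : ℕ) (u : H) :
    e (blaschkeProd S r n u) = (∏ i ∈ Finset.range n, r i : ℝ) * e u := by
  induction n generalizing u with
  | zero => simp [blaschkeProd]
  | succ n ih =>
    have := eval_blaschkeFactor_apply S (hr n) (y := 0) (by simpa using he) u
    simp only [mul_zero, sub_zero, one_mul] at this
    rw [blaschkeProd, mul_apply_eq_comp, ih, this, Finset.prod_range_succ]
    push_cast
    ring

/-- The increments of the finite Blaschke products applied to a wandering unit vector `v`. -/
theorem norm_blaschkeProd_add_sub_sq (S : H →ₗᵢ[ℂ] H) {r : ℕ → ℝ} (hr : ∀ n, |r n| < 1) {v : H}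
    (hv : ‖v‖ = 1) (hS : ∀ u, inner ℂ v (S u) = 0) (n k : ℕ) :
    ‖blaschkeProd S r (n + k) v - blaschkeProd S r n v‖ ^ 2 =
      2 - 2 * ∏ i ∈ Finset.range k, r (n + i) := by
  -- The first `n` factors form an isometry and drop out of the norm, leaving ‖B v - v‖² for the
  -- remaining `k` factors, where ⟨v, B v⟩ is the product of their values at 0.
  have hadd : blaschkeProd S r (n + k) =
      blaschkeProd S r n * blaschkeProd S (fun i => r (n + i)) k := by
    induction k with
    | zero => simp [blaschkeProd]
    | succ k ih => rw [← add_assoc, blaschkeProd, ih, blaschkeProd, mul_assoc]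
  have h := eval_zero_blaschkeProd_apply S (fun i => hr (n + i)) (e := innerSL ℂ v)
    (by simpa using hS) k v
  simp only [innerSL_apply_apply] at h
  generalize ∏ i ∈ Finset.range k, r (n + i) = P at h ⊢
  rw [hadd, mul_apply_eq_comp, ← map_sub, norm_blaschkeProd_apply S hr,
    @norm_sub_sq ℂ, norm_blaschkeProd_apply S (fun i => hr (n + i)), hv, ← inner_conj_symm, h,
    inner_self_eq_norm_sq_to_K, hv]
  simp only [map_mul, Complex.conj_ofReal]
  simp
  ring

theorem one_sub_sum_le_prod {r : ℕ → ℝ} (h0 : ∀ n, 0 ≤ r n) (h1 : ∀ n, r n ≤ 1) (k : ℕ) :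
    1 - ∑ i ∈ Finset.range k, (1 - r i) ≤ ∏ i ∈ Finset.range k, r i := by
  induction k with
  | zero => simp
  | succ k ih =>
    rw [Finset.sum_range_succ, Finset.prod_range_succ]
    have hP : ∏ i ∈ Finset.range k, r i ≤ 1 := Finset.prod_le_one (fun i _ => h0 i) fun i _ => h1 i
    nlinarith [h0 k, h1 k]

/-- The limit of the finite Blaschke products applied to a wandering vector: its value at `0` does
not vanish, and its value at each `r j` does. -/
theorem exists_blaschke_limit (S : H →ₗᵢ[ℂ] H) {r : ℕ → ℝ} (h0 : ∀ n, 0 < r n) (h1 : ∀ n, r n < 1)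
    (hs : Summable fun n => 1 - r n) {v : H} (hv : ‖v‖ = 1) (hS : ∀ u, inner ℂ v (S u) = 0) :
    ∃ g : H, inner ℂ v g ≠ 0 ∧
      ∀ (j : ℕ) (e : H →L[ℂ] ℂ), (∀ u, e (S u) = r j * e u) → e g = 0 := by
  have hr : ∀ n, |r n| < 1 := fun n => by rw [abs_of_pos (h0 n)]; exact h1 n
  have htail : ∀ n k, 1 - ∑' i, (1 - r (i + n)) ≤ ∏ i ∈ Finset.range k, r (n + i) := by
    intro n k
    refine le_trans ?_ (one_sub_sum_le_prod (r := fun i => r (n + i)) (fun i => (h0 _).le)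
      (fun i => (h1 _).le) k)
    have := ((summable_nat_add_iff n).mpr hs).sum_le_tsum (Finset.range k)
      fun i _ => sub_nonneg.mpr (h1 (i + n)).le
    simp only [add_comm n]
    linarith
  have ht := tendsto_sum_nat_add fun n => 1 - r n
  have hcau : CauchySeq fun n => blaschkeProd S r n v := by
    refine cauchySeq_of_le_tendsto_0' (fun n => √(2 * ∑' i, (1 - r (i + n)))) ?_ ?_
    · intro n m hnm
      obtain ⟨k, rfl⟩ := Nat.exists_eq_add_of_le hnm
      rw [dist_comm, dist_eq_norm]
      apply Real.le_sqrt_of_sq_le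
      rw [norm_blaschkeProd_add_sub_sq S hr hv hS]
      linarith [htail n k]
    · have := (ht.const_mul 2).sqrt
      simpa using this
  obtain ⟨g, hg⟩ := cauchySeq_tendsto_of_complete hcau
  refine ⟨g, ?_, fun j e he => ?_⟩
  -- Once the tail sum beyond `n` is below 1, the products of the remaining radii are bounded below
  -- by a positive constant, so the value at 0 survives in the limit.
  · obtain ⟨n, hn⟩ := (ht.eventually (gt_mem_nhds (zero_lt_one' ℝ))).exists
    have hlim : Tendsto (fun k => inner ℂ v (blaschkeProd S r k v)) atTop (𝓝 (inner ℂ v g)) :=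
      (innerSL ℂ v).continuous.continuousAt.tendsto.comp hg
    have hval : ∀ k, inner ℂ v (blaschkeProd S r k v) = ((∏ i ∈ Finset.range k, r i : ℝ) : ℂ) := by
      intro k
      have := eval_zero_blaschkeProd_apply S hr (e := innerSL ℂ v) (by simpa using hS) k v
      simpa [inner_self_eq_norm_sq_to_K, hv] using this
    set c := (∏ i ∈ Finset.range n, r i) * (1 - ∑' i, (1 - r (i + n)))
    have hc : 0 < c := mul_pos (Finset.prod_pos fun i _ => h0 i) (by linarith)
    have hge : ∀ᶠ k in atTop, c ≤ (inner ℂ v (blaschkeProd S r k v)).re := by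
      filter_upwards [eventually_ge_atTop n] with k hk
      obtain ⟨l, rfl⟩ := Nat.exists_eq_add_of_le hk
      rw [hval, Complex.ofReal_re, Finset.prod_range_add]
      exact mul_le_mul_of_nonneg_left (htail n l) (Finset.prod_nonneg fun i _ => (h0 i).le)
    have hle := ge_of_tendsto (Complex.continuous_re.continuousAt.tendsto.comp hlim) hge
    intro h
    rw [h, Complex.zero_re] at hle
    linarith
  · have hlim : Tendsto (fun k => e (blaschkeProd S r k v)) atTop (𝓝 (e g)) :=
      e.continuous.continuousAt.tendsto.comp hg
    refine tendsto_nhds_unique (hlim.congr' ?_) tendsto_const_nhds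
    filter_upwards [eventually_gt_atTop j] with k hk
    exact eval_blaschkeProd_apply_eq_zero S hr he hk v

end Isometry

/-- The Hilbert space of square summable functions from `ℕ` to `ℂ`. -/
abbrev L2N : Type := lp (fun _ : ℕ => ℂ) 2

/-- The function that is `0` at `0` and `u (k - 1)` at `k ≥ 1`. -/
def shiftFun (u : ℕ → ℂ) : ℕ → ℂ
  | 0 => 0
  | k + 1 => u k

/-- The unilateral shift. -/
def unilateralShift : L2N →ₗᵢ[ℂ] L2N where
  toFun u := ⟨shiftFun u, memℓp_gen (by
    rw [← summable_nat_add_iff 1]; exact (lp.memℓp u).summable (by norm_num))⟩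
  map_add' u v := by
    ext k
    cases k with
    | zero => exact (add_zero (0 : ℂ)).symm
    | succ k => rfl
  map_smul' c u := by
    ext k
    cases k with
    | zero => exact (mul_zero c).symm
    | succ k => rfl
  norm_map' u := by
    have h2 : 0 < (2 : ℝ≥0∞).toReal := by norm_num
    rw [lp.norm_eq_tsum_rpow h2, lp.norm_eq_tsum_rpow h2]
    congr 1
    have hs : Summable fun k => ‖shiftFun u k‖ ^ (2 : ℝ≥0∞).toReal := by
      rw [← summable_nat_add_iff 1]; exact (lp.memℓp u).summable (by norm_num)
    change ∑' k, ‖shiftFun u k‖ ^ (2 : ℝ≥0∞).toReal = _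
    rw [hs.tsum_eq_zero_add]
    simp [shiftFun]

theorem memlp_geometric {y : ℂ} (hy : ‖y‖ < 1) : Memℓp (fun k : ℕ => y ^ k) 2 := by
  apply memℓp_gen
  have : Summable fun k : ℕ => (‖y‖ ^ 2) ^ k :=
    summable_geometric_of_lt_one (by positivity) (by nlinarith [norm_nonneg y])
  refine this.congr fun k => ?_
  simp [← pow_mul, mul_comm]

/-- A Blaschke product with zeros `r j` has square summable Taylor coefficients. -/
theorem exists_L2N_zeros {r : ℕ → ℝ} (h0 : ∀ n, 0 < r n) (h1 : ∀ n, r n < 1)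
    (hs : Summable fun n => 1 - r n) :
    ∃ g : L2N, (g : ℕ → ℂ) 0 ≠ 0 ∧ ∀ j, ∑' k, (g : ℕ → ℂ) k * (r j : ℂ) ^ k = 0 := by
  obtain ⟨g, hg0, hg⟩ := exists_blaschke_limit unilateralShift h0 h1 hs
    (v := lp.single 2 0 (1 : ℂ)) (by simp [lp.norm_single])
    (fun u => by rw [lp.inner_single_left (𝕜 := ℂ) (G := fun _ : ℕ => ℂ)]; simp [unilateralShift, shiftFun])
  refine ⟨g, by
    rw [lp.inner_single_left (𝕜 := ℂ) (G := fun _ : ℕ => ℂ)] at hg0; simpa using hg0, fun j => ?_⟩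
  have hr : ‖(r j : ℂ)‖ < 1 := by
    rw [Complex.norm_real, Real.norm_of_nonneg (h0 j).le]; exact h1 j
  let p : L2N := ⟨_, memlp_geometric hr⟩
  have hp : ∀ u : L2N, HasSum (fun k => (u : ℕ → ℂ) k * (r j : ℂ) ^ k) (innerSL ℂ p u) := by
    intro u
    have := lp.hasSum_inner (𝕜 := ℂ) (G := fun _ : ℕ => ℂ) p u
    simpa [p, Complex.inner] using this
  -- Pairing with the geometric sequence of ratio `r j` is evaluation at `r j`, so the shift becomes
  -- multiplication by `r j`.
  have := hg j (innerSL ℂ p) fun u => by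
    rw [← (hp u).tsum_eq, ← (hp _).tsum_eq, (hp _).summable.tsum_eq_zero_add, ← tsum_mul_left]
    simp only [unilateralShift]
    simp [shiftFun, pow_succ]
    congr 1; ext k; ring
  rw [← (hp g).tsum_eq] at this
  exact this

end Blaschke

/-! ### The discrete Laplacian: spectrum and resolvent of the dipole -/

section Laplacian

open Filter Topology

theorem shiftL2Z_apply (n : ℤ) (u : L2Z) (k : ℤ) :
    (shiftL2Z n u : ℤ → ℂ) k = (u : ℤ → ℂ) (k + n) := rfl

theorem inner_shiftL2Z (n : ℤ) (u v : L2Z) :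
    inner ℂ (shiftL2Z n u) v = inner ℂ u (shiftL2Z (-n) v) := by
  rw [lp.inner_eq_tsum (𝕜 := ℂ) (G := fun _ : ℤ => ℂ),
    lp.inner_eq_tsum (𝕜 := ℂ) (G := fun _ : ℤ => ℂ)]
  conv_rhs => rw [← (Equiv.addRight n).tsum_eq]
  simp [shiftL2Z_apply]

theorem isSelfAdjoint_discreteLaplacian : IsSelfAdjoint discreteLaplacian := by
  rw [ContinuousLinearMap.isSelfAdjoint_iff_isSymmetric]
  intro u v
  have h1 := inner_shiftL2Z 1 u v
  have h2 := inner_shiftL2Z (-1) u v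
  rw [neg_neg] at h2
  simp [discreteLaplacian, inner_add_left, inner_add_right, h1, h2, add_comm]

theorem norm_discreteLaplacian_le : ‖discreteLaplacian‖ ≤ 2 := by
  refine (norm_add_le _ _).trans ?_
  have h1 := (shiftL2Z (-1)).norm_toContinuousLinearMap_le
  have h2 := (shiftL2Z 1).norm_toContinuousLinearMap_le
  linarith

instance : Nontrivial L2Z :=
  ⟨lp.single 2 0 (1 : ℂ), 0, fun h => by
    have := congrArg (fun u : L2Z => (u : ℤ → ℂ) 0) h
    simp at this⟩

theorem spectrum_discreteLaplacian_subset :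
    spectrum ℂ discreteLaplacian ⊆ realSegment (-2) 2 := by
  intro z hz
  have h1 := isSelfAdjoint_discreteLaplacian.mem_spectrum_eq_re hz
  have h2 := (spectrum.norm_le_norm_of_mem hz).trans norm_discreteLaplacian_le
  rw [h1, Complex.norm_real, Real.norm_eq_abs, abs_le] at h2
  exact ⟨z.re, h2, h1.symm⟩

theorem mem_resolventSet_discreteLaplacian {z : ℂ} (hz : z.im ≠ 0) :
    z ∈ resolventSet ℂ discreteLaplacian := by
  by_contra h
  obtain ⟨x, -, hx⟩ := spectrum_discreteLaplacian_subset h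
  exact hz (by rw [← hx]; simp)

theorem tendsto_norm_L2Z (u : L2Z) {f : ℕ → ℤ} (hf : Function.Injective f) :
    Tendsto (fun n => ‖(u : ℤ → ℂ) (f n)‖) atTop (𝓝 0) := by
  have h1 : Summable fun k => ‖(u : ℤ → ℂ) k‖ ^ 2 := by
    simpa using (lp.memℓp u).summable (by norm_num)
  have h2 := (h1.comp_injective hf).tendsto_atTop_zero.sqrt
  simpa [Function.comp_def] using h2

/-- On the spectrum of the Laplacian, decaying solutions of the recurrence vanish. -/
theorem eq_zero_of_recurrence {a : ℕ → ℂ} {x : ℝ} (hx : x ∈ Set.Icc (-2) 2)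
    (ha : ∀ n, a (n + 2) = x * a (n + 1) - a n) (h0 : Tendsto (fun n => ‖a n‖) atTop (𝓝 0))
    (n : ℕ) : a n = 0 := by
  have hq : 0 ≤ 1 - x ^ 2 / 4 := by nlinarith [hx.1, hx.2]
  -- The roots `c`, `d` of t² - x t + 1, unimodular because |x| ≤ 2. The recurrence multiplies
  -- a(n+1) - c a(n) by `d`, so its modulus is constant, hence 0 by decay; then |a(n)| is constant
  -- too.
  set c : ℂ := ⟨x / 2, √(1 - x ^ 2 / 4)⟩ with hc
  set d : ℂ := ⟨x / 2, -√(1 - x ^ 2 / 4)⟩ with hd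
  have hsq := Real.mul_self_sqrt hq
  have hcd : c * d = 1 := by
    apply Complex.ext <;> simp [hc, hd]
    · linarith
    · ring
  have hadd : c + d = x := by apply Complex.ext <;> simp [hc, hd]
  have hnorm : ∀ w : ℂ, Complex.normSq w = 1 → ‖w‖ = 1 := fun w hw => by
    rw [Complex.norm_def, hw, Real.sqrt_one]
  have hc1 : ‖c‖ = 1 := hnorm c (by simp [hc, Complex.normSq_apply]; linarith)
  have hd1 : ‖d‖ = 1 := hnorm d (by simp [hd, Complex.normSq_apply]; linarith)
  have h1 : ∀ n, ‖a (n + 1) - c * a n‖ = ‖a 1 - c * a 0‖ := by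
    intro n
    induction n with
    | zero => rfl
    | succ n ih =>
      rw [← ih, ha, ← hadd, show (c + d) * a (n + 1) - a n - c * a (n + 1) =
        d * (a (n + 1) - c * a n) by linear_combination a n * hcd, norm_mul, hd1, one_mul]
  have h2 : ‖a 1 - c * a 0‖ ≤ 0 := by
    have hlim := (h0.comp (tendsto_add_atTop_nat 1)).add h0
    rw [add_zero] at hlim
    refine ge_of_tendsto hlim (Eventually.of_forall fun n => ?_)
    rw [← h1 n]
    refine (norm_sub_le _ _).trans ?_
    rw [norm_mul, hc1, one_mul]
    rfl
  have h3 : ∀ n, ‖a n‖ = ‖a 0‖ := by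
    intro n
    induction n with
    | zero => rfl
    | succ n ih =>
      have := h1 n
      rw [le_antisymm h2 (norm_nonneg _), norm_eq_zero, sub_eq_zero] at this
      rw [this, norm_mul, hc1, one_mul, ih]
  have h4 : ‖a 0‖ = 0 := tendsto_nhds_unique (tendsto_const_nhds.congr fun n => (h3 n).symm) h0
  exact norm_eq_zero.mp ((h3 n).trans h4)

/-- If `x` in the segment were a resolvent point, the resolvent applied to the unit vector at 0
would solve the homogeneous recurrence on both half-lines. By decay it vanishes, contradicting the
equation at 0. -/
theorem spectrum_discreteLaplacian : spectrum ℂ discreteLaplacian = realSegment (-2) 2 := by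
  refine spectrum_discreteLaplacian_subset.antisymm ?_
  rintro _ ⟨x, hx, rfl⟩ hρ
  set u := resolvent discreteLaplacian (x : ℂ) (lp.single 2 0 (1 : ℂ)) with hu
  have h := sub_apply_resolvent hρ (lp.single 2 0 (1 : ℂ))
  rw [← hu] at h
  have hk : ∀ k : ℤ, (x : ℂ) * (u : ℤ → ℂ) k - ((u : ℤ → ℂ) (k - 1) + (u : ℤ → ℂ) (k + 1)) =
      (Pi.single 0 1 : ℤ → ℂ) k := by
    intro k
    exact congrArg (fun v : L2Z => (v : ℤ → ℂ) k) h
  have hp : ∀ n : ℕ, (u : ℤ → ℂ) n = 0 := by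
    refine eq_zero_of_recurrence (a := fun n : ℕ => (u : ℤ → ℂ) n) hx (fun n => ?_)
      (tendsto_norm_L2Z u Nat.cast_injective)
    have := hk (n + 1)
    rw [Pi.single_eq_of_ne (by omega), show (n + 1 - 1 : ℤ) = n by ring] at this
    rw [show ((n + 2 : ℕ) : ℤ) = n + 1 + 1 by push_cast; ring, Nat.cast_succ]
    linear_combination -this
  have hm : ∀ n : ℕ, (u : ℤ → ℂ) (-n) = 0 := by
    refine eq_zero_of_recurrence (a := fun n : ℕ => (u : ℤ → ℂ) (-n)) hx (fun n => ?_)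
      (tendsto_norm_L2Z u (neg_injective.comp Nat.cast_injective))
    have := hk (-(n + 1))
    rw [Pi.single_eq_of_ne (by omega), show (-(n + 1) + 1 : ℤ) = -n by ring] at this
    rw [show -((n + 2 : ℕ) : ℤ) = -(n + 1) - 1 by push_cast; ring, Nat.cast_succ]
    linear_combination -this
  have := hk 0
  have e0 := hp 0
  have e1 := hp 1
  have e2 := hm 1
  push_cast at e0 e1 e2
  simp [e0, e1, e2] at this

instance : TopologicalSpace.SeparableSpace L2Z := by
  rw [← TopologicalSpace.isSeparable_univ_iff]
  have hs : (Set.range fun i : ℤ => (lp.single 2 i (1 : ℂ) : L2Z)).Countable :=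
    Set.countable_range _
  refine (hs.isSeparable.span (R := ℂ)).closure.mono fun u _ => ?_
  refine mem_closure_of_tendsto (lp.hasSum_single (by norm_num) u)
    (Eventually.of_forall fun s => Submodule.sum_mem _ fun i _ => ?_)
  have : lp.single 2 i ((u : ℤ → ℂ) i) =
      (u : ℤ → ℂ) i • (lp.single 2 i (1 : ℂ) : L2Z) := by
    rw [← lp.single_smul, smul_eq_mul, mul_one]
  rw [this]
  exact Submodule.smul_mem _ _ (Submodule.subset_span ⟨i, rfl⟩)

/-- The odd sequence that equals `z ^ k` for `k ≥ 1`. -/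
def oddGeom (z : ℂ) (k : ℤ) : ℂ := (k.sign : ℂ) * z ^ k.natAbs

theorem oddGeom_neg (z : ℂ) (k : ℤ) : oddGeom z (-k) = -oddGeom z k := by simp [oddGeom]

theorem oddGeom_zero (z : ℂ) : oddGeom z 0 = 0 := by simp [oddGeom]

theorem oddGeom_natCast_succ (z : ℂ) (n : ℕ) : oddGeom z (n + 1) = z ^ (n + 1) := by
  have h1 : ((n : ℤ) + 1).sign = 1 := Int.sign_eq_one_of_pos (by omega)
  have h2 : ((n : ℤ) + 1).natAbs = n + 1 := by omega
  simp [oddGeom, h1, h2]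

theorem memlp_oddGeom {z : ℂ} (hz : ‖z‖ < 1) : Memℓp (oddGeom z) 2 := by
  apply memℓp_gen
  have hs : Summable fun n : ℕ => ‖oddGeom z n‖ ^ (2 : ℝ≥0∞).toReal := by
    rw [← summable_nat_add_iff 1]
    have := (memlp_geometric hz).summable (by norm_num)
    rw [← summable_nat_add_iff 1] at this
    refine this.congr fun n => ?_
    rw [Nat.cast_add, Nat.cast_one, oddGeom_natCast_succ]
  refine Summable.of_nat_of_neg hs ?_
  simpa only [oddGeom_neg, norm_neg] using hs

/-- The odd sequence `oddGeom` as an element of `ℓ²(ℤ)`. -/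
def oddGeomL2 {z : ℂ} (hz : ‖z‖ < 1) : L2Z := ⟨oddGeom z, memlp_oddGeom hz⟩

/-- The difference of the unit vectors at `1` and `-1`. -/
def dipole : L2Z := lp.single 2 1 (1 : ℂ) - lp.single 2 (-1) (1 : ℂ)

theorem dipole_apply (k : ℤ) : (dipole : ℤ → ℂ) k = if k = 1 then 1 else if k = -1 then -1 else 0 := by
  simp only [dipole, lp.coeFn_sub, lp.coeFn_single, Pi.sub_apply, Pi.single_apply]
  split_ifs <;> first | omega | simp

/-- Powers of `z` solve the recurrence. At 0 the neighbours cancel by oddness, and at 1 the entry 0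
in place of z ^ 0 leaves the defect 1. The dipole thus avoids the factor (z⁻¹ - z)⁻¹ that a single
unit vector would bring. -/
theorem sub_apply_oddGeomL2 {z : ℂ} (hz : ‖z‖ < 1) (h0 : z ≠ 0) :
    (z + z⁻¹) • oddGeomL2 hz - discreteLaplacian (oddGeomL2 hz) = dipole := by
  have key : ∀ k : ℤ, 0 ≤ k → (z + z⁻¹) * oddGeom z k - (oddGeom z (k - 1) + oddGeom z (k + 1)) =
      (dipole : ℤ → ℂ) k := by
    intro k hk
    lift k to ℕ using hk
    rcases k with _ | _ | n
    · have h1 := oddGeom_neg z 1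
      simp [oddGeom_zero, dipole_apply, h1]
    · have h1 := oddGeom_natCast_succ z 0
      have h2 := oddGeom_natCast_succ z 1
      norm_num at h1 h2
      simp only [zero_add, Nat.cast_one, sub_self, oddGeom_zero, dipole_apply, if_true]
      norm_num
      rw [h1, h2]
      field_simp
      ring
    · have h1 := oddGeom_natCast_succ z n
      have h2 := oddGeom_natCast_succ z (n + 1)
      have h3 := oddGeom_natCast_succ z (n + 2)
      push_cast at h1 h2 h3 ⊢
      rw [dipole_apply, if_neg (by omega), if_neg (by omega),
        show ((n : ℤ) + 1 + 1 - 1) = n + 1 by ring, h1, h2,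
        show ((n : ℤ) + 1 + 1 + 1) = n + 2 + 1 by ring, h3]
      field_simp
      ring
  have key' : ∀ k : ℤ, (z + z⁻¹) * oddGeom z k - (oddGeom z (k - 1) + oddGeom z (k + 1)) =
      (dipole : ℤ → ℂ) k := by
    intro k
    rcases le_total 0 k with hk | hk
    · exact key k hk
    · have h := key (-k) (by omega)
      have hd : (dipole : ℤ → ℂ) (-k) = -(dipole : ℤ → ℂ) k := by
        simp only [dipole_apply]
        split_ifs <;> first | omega | simp
      rw [hd, show -k - 1 = -(k + 1) by ring, show -k + 1 = -(k - 1) by ring] at h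
      simp only [oddGeom_neg] at h
      linear_combination -h
  ext k
  exact key' k

theorem resolvent_dipole {z : ℂ} (hz : ‖z‖ < 1) (h0 : z ≠ 0)
    (hρ : z + z⁻¹ ∈ resolventSet ℂ discreteLaplacian) :
    resolvent discreteLaplacian (z + z⁻¹) dipole = oddGeomL2 hz := by
  rw [← sub_apply_oddGeomL2 hz h0, resolvent_sub_apply hρ]

/-- The functional whose perturbation determinant with respect to `dipole` is
`z ↦ ∑ f k * z ^ k`, if `f 0 = 1`. -/
theorem exists_functional (f : L2N) (hf : (f : ℕ → ℂ) 0 = 1) :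
    ∃ φ : L2Z →L[ℂ] ℂ, ∀ (z : ℂ) (hz : ‖z‖ < 1),
      1 - φ (oddGeomL2 hz) = ∑' k, (f : ℕ → ℂ) k * z ^ k := by
  let ι : ℕ → ℤ := fun n => n + 1
  have hι : Function.Injective ι := fun a b h => by simpa [ι] using h
  -- Supported on k ≥ 1, where the odd sequence is z ^ k; the conjugate undoes the conjugation in
  -- the first slot of the inner product.
  let d : ℤ → ℂ := Function.extend ι (fun n => -(starRingEnd ℂ) ((f : ℕ → ℂ) (n + 1))) 0
  have hdι : ∀ n, d (ι n) = -(starRingEnd ℂ) ((f : ℕ → ℂ) (n + 1)) := fun n => hι.extend_apply _ _ _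
  have hd0 : ∀ k, k ∉ Set.range ι → d k = 0 := fun k hk =>
    Function.extend_apply' _ _ _ fun ⟨a, ha⟩ => hk ⟨a, ha⟩
  have hd : Memℓp d 2 := by
    apply memℓp_gen
    rw [← hι.summable_iff fun k hk => by simp [hd0 k hk]]
    have := (lp.memℓp f).summable (by norm_num)
    rw [← summable_nat_add_iff 1] at this
    refine this.congr fun n => ?_
    simp [hdι]
  refine ⟨innerSL ℂ (⟨d, hd⟩ : L2Z), fun z hz => ?_⟩
  have hsum := lp.hasSum_inner (𝕜 := ℂ) (G := fun _ : ℤ => ℂ) ⟨d, hd⟩ (oddGeomL2 hz)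
  rw [← hι.hasSum_iff fun k hk => by simp [hd0 k hk]] at hsum
  have hterm : ∀ n : ℕ, inner ℂ (d (ι n)) (oddGeom z (ι n)) =
      -((f : ℕ → ℂ) (n + 1) * z ^ (n + 1)) := by
    intro n
    rw [hdι, show oddGeom z (ι n) = z ^ (n + 1) from oddGeom_natCast_succ z n]
    simp
    ring
  have hsum' : HasSum (fun n : ℕ => (f : ℕ → ℂ) (n + 1) * z ^ (n + 1))
      (-(innerSL ℂ (⟨d, hd⟩ : L2Z) (oddGeomL2 hz))) := by
    have := hsum.neg
    refine (this.congr_fun ?_)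
    intro n
    simp only [Function.comp]
    exact (neg_eq_iff_eq_neg.mpr (hterm n)).symm
  have := (hasSum_nat_add_iff (f := fun n => (f : ℕ → ℂ) n * z ^ n) 1).mp hsum'
  rw [this.tsum_eq]
  simp [hf]
  ring

/-- By the identity theorem on a disk of radius ρ < 1, local vanishing would propagate to 0, where
the value is 1. -/
theorem not_eventually_tsum_eq_zero (f : L2N) (hf : (f : ℕ → ℂ) 0 = 1) {z : ℂ} (hz : ‖z‖ < 1) :
    ¬ ∀ᶠ w in 𝓝 z, ∑' k, (f : ℕ → ℂ) k * w ^ k = 0 := by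
  intro h
  obtain ⟨ρ, h1, h2⟩ := exists_between hz
  have h0 : 0 < ρ := (norm_nonneg z).trans_lt h1
  have hd : DifferentiableOn ℂ (fun w : ℂ => ∑' k, (f : ℕ → ℂ) k * w ^ k) (Metric.ball 0 ρ) := by
    refine Complex.differentiableOn_tsum_of_summable_norm (u := fun k => ‖f‖ * ρ ^ k)
      ((summable_geometric_of_lt_one h0.le h2).mul_left _) (fun k => by fun_prop)
      Metric.isOpen_ball fun k w hw => ?_
    rw [norm_mul, norm_pow]
    have hw' : ‖w‖ ≤ ρ := by simpa using (Metric.mem_ball.mp hw).le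
    have := lp.norm_apply_le_norm (p := 2) (by norm_num) f k
    gcongr
  have hA := hd.analyticOnNhd Metric.isOpen_ball
  have hz' : z ∈ Metric.ball (0 : ℂ) ρ := by simpa using h1
  have hE := hA.eqOn_zero_of_preconnected_of_eventuallyEq_zero
    (convex_ball 0 ρ).isPreconnected hz' h
  have := hE (Metric.mem_ball_self h0)
  simp only [Pi.zero_apply] at this
  rw [tsum_eq_single 0 (fun k hk => by simp [hk])] at this
  simp [hf] at this

end Laplacian

/-! ### Schatten norms of rank-one operators and divergence of eigenvalue sums -/

section RankOneSchatten

variable {H : Type*} [NormedAddCommGroup H] [InnerProductSpace ℂ H]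

theorem rank_smulRight_eq_one {φ : H →L[ℂ] ℂ} {ψ : H} (hφ : φ ≠ 0) (hψ : ψ ≠ 0) :
    LinearMap.rank (φ.smulRight ψ : H →ₗ[ℂ] H) = 1 := by
  have hr : LinearMap.range (φ.smulRight ψ : H →ₗ[ℂ] H) = Submodule.span ℂ {ψ} := by
    apply le_antisymm
    · rintro _ ⟨v, rfl⟩
      exact Submodule.mem_span_singleton.mpr ⟨φ v, rfl⟩
    · obtain ⟨v, hv⟩ := DFunLike.ne_iff.mp hφ
      rw [Submodule.span_singleton_le_iff_mem]
      refine ⟨(φ v)⁻¹ • v, ?_⟩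
      have : φ v ≠ 0 := hv
      simp [this]
  unfold LinearMap.rank
  rw [hr, ← Module.finrank_eq_rank, finrank_span_singleton hψ, Nat.cast_one]

theorem inSchattenClass_smulRight {p : ℝ} (hp : 0 < p) {φ : H →L[ℂ] ℂ} {ψ : H}
    (hM : LinearMap.rank (φ.smulRight ψ : H →ₗ[ℂ] H) = 1) :
    InSchattenClass p (φ.smulRight ψ) := by
  refine ⟨?_, ?_⟩
  · have hφ : IsCompactOperator φ := isCompactOperator_of_locallyCompactSpace_dom φ
    exact hφ.clm_comp (ContinuousLinearMap.toSpanSingleton ℂ ψ)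
  · have h0 : ∀ n, n ≠ 0 → singularValue (φ.smulRight ψ) n = 0 := by
      intro n hn
      have hle : LinearMap.rank (φ.smulRight ψ : H →ₗ[ℂ] H) ≤ n := by
        rw [hM]
        exact_mod_cast Nat.one_le_iff_ne_zero.mpr hn
      refine le_antisymm ?_ zero_le
      refine (ciInf_le (OrderBot.bddBelow _) ⟨φ.smulRight ψ, hle⟩).trans ?_
      simp
    rw [schattenPow, tsum_eq_single 0 fun n hn => by rw [h0 n hn, NNReal.zero_rpow hp.ne']; rfl]
    exact ENNReal.coe_lt_top

/-- Comparison with the harmonic series: multiplicities are at least 1, and injectivity of `l`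
prevents counting an eigenvalue twice. -/
theorem tsum_discreteSpectrum_eq_top {B : H →L[ℂ] H} {w : ℂ → ℝ} {l : ℕ → ℂ}
    (hl : Function.Injective l) (hmem : ∀ n, l n ∈ discreteSpectrum B)
    (hw : ∀ n : ℕ, 1 / ((n + 2 : ℕ) : ℝ) ≤ w (l n)) :
    ∑' z : discreteSpectrum B, (algMult B (z : ℂ) : ℝ≥0∞) * ENNReal.ofReal (w z) = ∞ := by
  let i : ℕ → discreteSpectrum B := fun n => ⟨l n, hmem n⟩
  have hi : Function.Injective i := fun a b h => hl (congrArg Subtype.val h)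
  have hdiv : ∑' n : ℕ, ENNReal.ofReal (1 / ((n + 2 : ℕ) : ℝ)) = ∞ := by
    by_contra h
    have hs := ENNReal.summable_toReal h
    simp only [ENNReal.toReal_ofReal (show (0 : ℝ) ≤ 1 / ((_ + 2 : ℕ) : ℝ) by positivity)] at hs
    exact Real.not_summable_one_div_natCast
      ((summable_nat_add_iff (f := fun n : ℕ => 1 / (n : ℝ)) 2).mp hs)
  refine top_le_iff.mp (hdiv.symm.le.trans (le_trans (ENNReal.tsum_le_tsum fun n => ?_)
    (ENNReal.tsum_comp_le_tsum_of_injective hi _)))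
  have h1 : (1 : ℝ≥0∞) ≤ algMult B (l n) := by exact_mod_cast one_le_algMult (hmem n)
  calc ENNReal.ofReal (1 / ((n + 2 : ℕ) : ℝ)) ≤ 1 * ENNReal.ofReal (w (l n)) := by
        rw [one_mul]; exact ENNReal.ofReal_le_ofReal (hw n)
    _ ≤ _ := by gcongr

end RankOneSchatten

/-! ### Choice of the radii and geometry of the points on the imaginary axis -/

section ImaginaryPoints

/-- A Blaschke sequence on a ray for which the sum of the powers `γ < 1` diverges. -/
theorem exists_radii {γ : ℝ} (hγ : γ < 1) :
    ∃ r : ℕ → ℝ, Function.Injective r ∧ (∀ n, 0 < r n) ∧ (∀ n, r n < 1) ∧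
      (Summable fun n => 1 - r n) ∧
      ∀ (n : ℕ) (s : ℝ), 1 - r n ≤ s → s ≤ 1 → 1 / ((n + 2 : ℕ) : ℝ) ≤ s ^ γ := by
  -- Any exponent in (0, 1) that is at least γ would do; the maximum also covers γ ≤ 0.
  set δ := max γ (1 / 2) with hδ
  have hδ0 : 0 < δ := lt_of_lt_of_le (by norm_num) (le_max_right _ _)
  have hδ1 : δ < 1 := max_lt hγ (by norm_num)
  have hexp : 1 < δ⁻¹ := (one_lt_inv₀ hδ0).mpr hδ1
  -- Chosen so that t(n)^δ = 1/(n + 2), while δ⁻¹ > 1 makes the sum of t(n) finite. The shift by 2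
  -- keeps t(n) < 1.
  let t : ℕ → ℝ := fun n => ((n + 2 : ℕ) : ℝ) ^ (-δ⁻¹)
  have ht0 : ∀ n, 0 < t n := fun n => by positivity
  have ht1 : ∀ n, t n < 1 := fun n =>
    Real.rpow_lt_one_of_one_lt_of_neg (by push_cast; linarith [n.cast_nonneg (α := ℝ)])
      (by linarith)
  refine ⟨fun n => 1 - t n, fun a b hab => ?_, fun n => by linarith [ht1 n],
    fun n => by linarith [ht0 n], ?_, fun n s hs hs1 => ?_⟩
  · have h : t a = t b := by simpa using hab
    have := (Real.rpow_left_inj (by positivity) (by positivity) (by linarith)).mp h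
    have := Nat.cast_injective (R := ℝ) this
    omega
  · simp only [sub_sub_cancel]
    exact (summable_nat_add_iff (f := fun n : ℕ => (n : ℝ) ^ (-δ⁻¹)) 2).mpr
      (Real.summable_nat_rpow.mpr (by linarith))
  · have hs' : t n ≤ s := by simpa using hs
    calc 1 / ((n + 2 : ℕ) : ℝ) = t n ^ δ := by
          rw [← Real.rpow_mul (by positivity), neg_mul, inv_mul_cancel₀ hδ0.ne', Real.rpow_neg_one,
            one_div]
      _ ≤ s ^ δ := Real.rpow_le_rpow (ht0 n).le hs' hδ0.le
      _ ≤ s ^ γ := Real.rpow_le_rpow_of_exponent_ge ((ht0 n).trans_le hs') hs1 (le_max_left _ _)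

/-- The image of `i r` under the Joukowski map `z ↦ z + z⁻¹`. -/
def joukowskiImag (r : ℝ) : ℂ := (r - r⁻¹ : ℝ) * Complex.I

theorem joukowskiImag_eq (r : ℝ) :
    joukowskiImag r = r * Complex.I + (r * Complex.I)⁻¹ := by
  simp [joukowskiImag]
  ring

theorem joukowskiImag_im (r : ℝ) : (joukowskiImag r).im = r - r⁻¹ := by
  simp [joukowskiImag]

theorem joukowskiImag_injOn : Set.InjOn joukowskiImag (Set.Ioi 0) := by
  intro a ha b hb hab
  have ha : 0 < a := ha
  have hb : 0 < b := hb
  have h := congrArg Complex.im hab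
  rw [joukowskiImag_im, joukowskiImag_im] at h
  field_simp at h
  have h2 : (a - b) * (a * b + 1) = 0 := by linear_combination h
  have : a * b + 1 ≠ 0 := by positivity
  exact sub_eq_zero.mp ((mul_eq_zero.mp h2).resolve_right this)

theorem infDist_joukowskiImag {r : ℝ} (h0 : 0 < r) (h1 : r < 1) :
    Metric.infDist (joukowskiImag r) (realSegment (-2) 2) = r⁻¹ - r := by
  have hlt : r < r⁻¹ := h1.trans ((one_lt_inv₀ h0).mpr h1)
  have hmem : (0 : ℂ) ∈ realSegment (-2) 2 := ⟨0, by norm_num, by simp⟩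
  apply le_antisymm
  · refine (Metric.infDist_le_dist_of_mem hmem).trans_eq ?_
    rw [dist_zero_right, joukowskiImag, norm_mul, Complex.norm_I, mul_one, Complex.norm_real,
      Real.norm_eq_abs, abs_of_neg (by linarith)]
    ring
  · rw [Metric.le_infDist ⟨0, hmem⟩]
    rintro _ ⟨x, -, rfl⟩
    have := Complex.abs_im_le_norm (joukowskiImag r - x)
    rw [Complex.sub_im, joukowskiImag_im, Complex.ofReal_im, sub_zero, abs_of_neg (by linarith)]
      at this
    rw [dist_eq_norm]
    linarith

theorem norm_joukowskiImag_sub {r x : ℝ} (h0 : 0 < r) (hx : x ^ 2 = 4) :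
    ‖joukowskiImag r - x‖ = r + r⁻¹ := by
  rw [← sq_eq_sq₀ (norm_nonneg _) (by positivity), ← Complex.normSq_eq_norm_sq,
    Complex.normSq_apply]
  have hre : (joukowskiImag r - x).re = -x := by simp [joukowskiImag]
  have him : (joukowskiImag r - x).im = r - r⁻¹ := by simp [joukowskiImag_im]
  rw [hre, him]
  have : r * r⁻¹ = 1 := mul_inv_cancel₀ h0.ne'
  linear_combination hx - 4 * this

theorem joukowskiInv_joukowski {z : ℂ} (hz : ‖z‖ < 1) (h0 : z ≠ 0) :
    joukowskiInv ((z + z⁻¹) / 2) = z := by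
  have hs : ((((z + z⁻¹) / 2) ^ 2 - 1) ^ (1 / 2 : ℂ)) ^ 2 = ((z - z⁻¹) / 2) ^ 2 := by
    have := Complex.cpow_nat_inv_pow (((z + z⁻¹) / 2) ^ 2 - 1) two_ne_zero
    rw [one_div]
    push_cast at this
    rw [this]
    field_simp
    ring
  have hinv : ¬ ‖z⁻¹‖ < 1 := by
    rw [norm_inv, not_lt]
    exact (one_lt_inv₀ (norm_pos_iff.mpr h0)).mpr hz |>.le
  unfold joukowskiInv
  rcases sq_eq_sq_iff_eq_or_eq_neg.mp hs with h | h
  · simp only [h]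
    rw [show (z + z⁻¹) / 2 - (z - z⁻¹) / 2 = z⁻¹ by ring, if_neg hinv]
    ring
  · simp only [h]
    rw [show (z + z⁻¹) / 2 - -((z - z⁻¹) / 2) = z by ring, if_pos hz]

theorem norm_conformalK_joukowskiImag {r : ℝ} (h0 : 0 < r) (h1 : r < 1) :
    ‖conformalK (-2) 2 (joukowskiImag r)‖ = r := by
  have hn : ‖(r * Complex.I : ℂ)‖ = r := by simp [abs_of_pos h0]
  have : conformalK (-2) 2 (joukowskiImag r) = r * Complex.I := by
    rw [conformalK, ← joukowskiInv_joukowski (z := r * Complex.I) (by rwa [hn])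
      (norm_pos_iff.mp (by rwa [hn])), ← joukowskiImag_eq]
    congr 1
    push_cast
    ring
  rw [this, hn]

theorem dist_term_joukowskiImag {r : ℝ} (γ : ℝ) (h0 : 0 < r) (h1 : r < 1) :
    Metric.infDist (joukowskiImag r) (realSegment (-2) 2) ^ γ /
      (‖joukowskiImag r - (-2 : ℝ)‖ ^ (γ / 2) * ‖joukowskiImag r - (2 : ℝ)‖ ^ (γ / 2)) =
      ((r⁻¹ - r) / (r + r⁻¹)) ^ γ := by
  have hlt : r < r⁻¹ := h1.trans ((one_lt_inv₀ h0).mpr h1)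
  have hpos : 0 < r + r⁻¹ := by positivity
  rw [infDist_joukowskiImag h0 h1, norm_joukowskiImag_sub h0 (by norm_num),
    norm_joukowskiImag_sub h0 (by norm_num), ← Real.rpow_add hpos, add_halves,
    Real.div_rpow (by linarith) hpos.le]

/-- The ratio equals (1 - r)(1 + r)/(1 + r²), and 1 + r² ≤ 1 + r. -/
theorem one_sub_le_dist_ratio {r : ℝ} (h0 : 0 < r) (h1 : r < 1) :
    1 - r ≤ (r⁻¹ - r) / (r + r⁻¹) ∧ (r⁻¹ - r) / (r + r⁻¹) ≤ 1 := by
  have hpos : 0 < r + r⁻¹ := by positivity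
  have hr : r * r⁻¹ = 1 := mul_inv_cancel₀ h0.ne'
  constructor
  · rw [le_div_iff₀ hpos]
    nlinarith
  · rw [div_le_one hpos]
    linarith

end ImaginaryPoints

/-- A rank-one perturbation of the Laplacian with prescribed eigenvalues on the imaginary axis. -/
theorem exists_rankOne_eigenvalues {r : ℕ → ℝ} (h0 : ∀ n, 0 < r n) (h1 : ∀ n, r n < 1)
    (hs : Summable fun n => 1 - r n) :
    ∃ (φ : L2Z →L[ℂ] ℂ) (ψ : L2Z), φ ≠ 0 ∧ ψ ≠ 0 ∧
      ∀ n, joukowskiImag (r n) ∈ discreteSpectrum (discreteLaplacian + φ.smulRight ψ) := by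
  obtain ⟨g, hg0, hg⟩ := exists_L2N_zeros h0 h1 hs
  -- Rotation by (-i)^k moves the zeros from `r n` to i `r n`; the prefactor makes the constant term
  -- 1.
  let F : ℕ → ℂ := fun k => ((g : ℕ → ℂ) 0)⁻¹ * ((-Complex.I) ^ k * (g : ℕ → ℂ) k)
  have hF : Memℓp F 2 := by
    have h := ((lp.memℓp g).summable (by norm_num)).mul_left
      (‖((g : ℕ → ℂ) 0)⁻¹‖ ^ (2 : ℝ≥0∞).toReal)
    refine memℓp_gen (h.congr fun k => ?_)
    simp [F, mul_pow]
  let f : L2N := ⟨F, hF⟩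
  have hf : (f : ℕ → ℂ) 0 = 1 := by simp [f, F, hg0]
  obtain ⟨φ, hφ⟩ := exists_functional f hf
  have hnorm : ∀ n, ‖(r n * Complex.I : ℂ)‖ = r n := fun n => by simp [abs_of_pos (h0 n)]
  have hlt : ∀ n, ‖(r n * Complex.I : ℂ)‖ < 1 := fun n => by rw [hnorm]; exact h1 n
  have hne : ∀ n, (r n * Complex.I : ℂ) ≠ 0 := fun n => norm_pos_iff.mp (by rw [hnorm]; exact h0 n)
  have hzero : ∀ n, ∑' k, (f : ℕ → ℂ) k * (r n * Complex.I) ^ k = 0 := by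
    intro n
    have : ∀ k, (f : ℕ → ℂ) k * (r n * Complex.I) ^ k =
        ((g : ℕ → ℂ) 0)⁻¹ * ((g : ℕ → ℂ) k * (r n : ℂ) ^ k) := by
      intro k
      have hI : (-Complex.I) ^ k * Complex.I ^ k = 1 := by rw [← mul_pow]; simp
      simp only [f, F, mul_pow]
      linear_combination ((g : ℕ → ℂ) 0)⁻¹ * (g : ℕ → ℂ) k * (r n : ℂ) ^ k * hI
    simp only [this]
    rw [tsum_mul_left, hg n, mul_zero]
  have hψ : dipole ≠ 0 := fun h => by
    have := dipole_apply 1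
    rw [h] at this
    simp at this
  refine ⟨φ, dipole, ?_, hψ, fun n => ?_⟩
  · rintro rfl
    have := hφ _ (hlt 0)
    rw [hzero 0] at this
    simp at this
  · have hdet : ∀ z : ℂ, ‖z‖ < 1 → z ≠ 0 → z + z⁻¹ ∈ resolventSet ℂ discreteLaplacian →
        pertDet discreteLaplacian φ dipole (z + z⁻¹) = ∑' k, (f : ℕ → ℂ) k * z ^ k := by
      intro z hz hz0 hρ
      rw [pertDet, resolvent_dipole hz hz0 hρ, hφ]
    have hρ : joukowskiImag (r n) ∈ resolventSet ℂ discreteLaplacian := by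
      apply mem_resolventSet_discreteLaplacian
      rw [joukowskiImag_im]
      have := (one_lt_inv₀ (h0 n)).mpr (h1 n)
      linarith [h1 n]
    refine mem_discreteSpectrum_add_smulRight hρ ?_ fun hev => ?_
    · rw [joukowskiImag_eq] at hρ ⊢
      rw [hdet _ (hlt n) (hne n) hρ, hzero]
    -- If the determinant vanished near the eigenvalue, its pullback under z + z⁻¹, which is the
    -- power series, would vanish near i `r n`.
    · refine not_eventually_tsum_eq_zero f hf (hlt n) ?_
      have hc : ContinuousAt (fun z : ℂ => z + z⁻¹) (r n * Complex.I) :=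
        continuousAt_id.add (continuousAt_inv₀ (hne n))
      rw [joukowskiImag_eq] at hev hρ
      filter_upwards [hc.eventually hev,
        hc.eventually ((spectrum.isOpen_resolventSet discreteLaplacian).eventually_mem hρ),
        continuous_norm.continuousAt.eventually_lt_const (hlt n),
        continuousAt_id.eventually_ne (hne n)] with w hw1 hw2 hw3 hw4
      rw [← hdet w hw3 hw4 hw2, hw1]

end

theorem proposition6p2 (γ : ℝ) (hγ : γ < 1) :
    (∃ M : L2Z →L[ℂ] L2Z, LinearMap.rank (M : L2Z →ₗ[ℂ] L2Z) = 1 ∧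
      distSum (-2) 2 γ (discreteLaplacian + M) = ∞) ∧
    (∀ p : ℝ, 0 < p → ¬ ConformalBound (-2) 2 p γ ∧ ¬ DistBound (-2) 2 p γ) := by
  obtain ⟨r, hinj, h0, h1, hs, hr⟩ := exists_radii hγ
  obtain ⟨φ, ψ, hφ, hψ, hmem⟩ := exists_rankOne_eigenvalues h0 h1 hs
  have hrank := rank_smulRight_eq_one hφ hψ
  have hl : Function.Injective fun n => joukowskiImag (r n) := fun a b h =>
    hinj (joukowskiImag_injOn (h0 a) (h0 b) h)
  have hdist : distSum (-2) 2 γ (discreteLaplacian + φ.smulRight ψ) = ∞ := by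
    refine tsum_discreteSpectrum_eq_top (w := fun z => Metric.infDist z (realSegment (-2) 2) ^ γ /
      (‖z - (-2 : ℝ)‖ ^ (γ / 2) * ‖z - (2 : ℝ)‖ ^ (γ / 2))) hl hmem fun n => ?_
    have h := one_sub_le_dist_ratio (h0 n) (h1 n)
    rw [dist_term_joukowskiImag γ (h0 n) (h1 n)]
    exact hr n _ h.1 h.2
  have hconf : conformalSum (-2) 2 γ (discreteLaplacian + φ.smulRight ψ) = ∞ := by
    refine tsum_discreteSpectrum_eq_top (w := fun z => (1 - ‖conformalK (-2) 2 z‖) ^ γ) hl hmem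
      fun n => ?_
    rw [norm_conformalK_joukowskiImag (h0 n) (h1 n)]
    exact hr n _ le_rfl (by linarith [h0 n])
  refine ⟨⟨φ.smulRight ψ, hrank, hdist⟩, fun p hp => ?_⟩
  have hS := inSchattenClass_smulRight hp hrank
  have hsub : discreteLaplacian + φ.smulRight ψ - discreteLaplacian = φ.smulRight ψ :=
    add_sub_cancel_left _ _
  constructor
  · rintro ⟨K, hK⟩
    have := hK L2Z discreteLaplacian (discreteLaplacian + φ.smulRight ψ)
      isSelfAdjoint_discreteLaplacian spectrum_discreteLaplacian (by rwa [hsub])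
    rw [hsub, hconf, top_le_iff] at this
    exact (ENNReal.mul_lt_top ENNReal.coe_lt_top hS.2).ne this
  · rintro ⟨K, hK⟩
    have := hK L2Z discreteLaplacian (discreteLaplacian + φ.smulRight ψ)
      isSelfAdjoint_discreteLaplacian spectrum_discreteLaplacian (by rwa [hsub])
    rw [hsub, hdist, top_le_iff] at this
    exact (ENNReal.mul_lt_top ENNReal.coe_lt_top hS.2).ne this
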